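/- Let $n\ge 2$, $\overline{\mathbb R^n}=\mathbb R^n\cup\{\infty\}$, and let $h$ be the chordal metric, $h(x,y)=\frac{|x-y|}{\sqrt{1+|x|^2}\sqrt{1+|y|^2}}$ for $x,y\neq\infty$ and $h(x,\infty)=\frac1{\sqrt{1+|x|^2}}$ for $x\ne\infty$; put $h(S)=\sup_{x,y\in S}h(x,y)$ and $h(S,T)=\inf_{x\in S,\,y\in T}h(x,y)$. Boundaries and closures are taken in $\overline{\mathbb R^n}$; a domain is a nonempty connected open set and a continuum is a nonempty connected compact set. $M$ denotes the ($n$-)modulus of a path family, $M(\Gamma)=\inf_\rho\int_{\mathbb R^n}\rho^n\,dm$ over all Borel $\rho:\mathbb R^n\to[0,\infty]$ with $\int_\gamma\rho\,ds\ge1$ for every locally rectifiable $\gamma\in\Gamma$ (a path through $\infty$ is not locally rectifiable). $\Gamma(E,F,D)$ is the family of paths $\gamma:[0,1]\to\overline{\mathbb R^n}$ with $\gamma(0)\in E$, $\gamma(1)\in F$ and $\gamma(t)\in D$ for $0<t<1$. Let $D\subset\mathbb R^n$ be a bounded domain that is locally connected on $\overline D$: for every $x_0\in\overline D$, every neighbourhood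 $U$ of $x_0$ contains a neighbourhood $V$ of $x_0$ such that $V\cap D$ is connected. Let $D'\subset\overline{\mathbb R^n}$ be a domain no connected component of whose boundary is a single point, and whose boundary is weakly flat: for every $y_0\in\partial D'$, every $P>0$ and every neighbourhood $U$ of $y_0$ there is a neighbourhood $V\subset U$ of $y_0$ such that $M(\Gamma(E,F,D'))>P$ for all continua $E,F\subset D'$ each of which meets both $\partial U$ and $\partial V$. Let $Q:\mathbb R^n\to[0,\infty]$ be Lebesgue measurable, with $Q=0$ outside $D$ and $\int_D Q\,dm<\infty$. Let $f_m$, $m=1,2,\dots$, be ring $Q$-homeomorphisms in $D$ of $D$ onto $D'$, that is, homeomorphisms of $D$ onto $D'$ such that, for every $x_0\in D$, all $0<r_1<r_2<\sup_{x\in D}|x-x_0|$ and every measurable $\eta:(r_1,r_2)\to[0,\infty]$ with $\int_{r_1}^{r_2}\eta(r)\,dr\ge1$, $$M\bigl(f_m(\Gamma(S(x_0,r_1),S(x_0,r_2),D))\bigr)\le\int_{\{x\in D:\ r_1<|x-x_0|<r_2\}}Q(x)\,\eta(|x-x_0|)^n\,dm(x),$$ where $S(x_0,r)=\{x\in\mathbb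 R^n:|x-x_0|=r\}$ and the image of a path $\gamma$ is $f_m\circ\gamma|_{(0,1)}$. Let $A\subset D$ be a continuum and let $\delta>0$ be such that $h(f_m(A))\ge\delta$ for all $m$. Then there exists $\delta_1>0$ such that $h(f_m(A),\partial D')>\delta_1$ for all $m$. -/

import Mathlib

open Set Filter Topology MeasureTheory
open scoped ENNReal

noncomputable section

/-- The chordal (spherical) distance on the one-point compactification of a normed space. -/
def chordal {E : Type*} [NormedAddCommGroup E] : OnePoint E → OnePoint E → ℝ
  | some x, some y => ‖x - y‖ / (√(1 + ‖x‖ ^ 2) * √(1 + ‖y‖ ^ 2))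
  | some x, none => 1 / √(1 + ‖x‖ ^ 2)
  | none, some y => 1 / √(1 + ‖y‖ ^ 2)
  | none, none => 0

/-- The chordal diameter `h(S)` of a set (`chordal` takes values in `[0, 1]`). -/
def chordalDiam {E : Type*} [NormedAddCommGroup E] (S : Set (OnePoint E)) : ℝ :=
  sSup (image2 chordal S S)

/-- The chordal distance `h(S, T)` of two nonempty sets. For an empty set the value is `0`. -/
def chordalDist {E : Type*} [NormedAddCommGroup E] (S T : Set (OnePoint E)) : ℝ :=
  sInf (image2 chordal S T)

/-- A domain: a nonempty connected open set. -/
def IsDomainSet {X : Type*} [TopologicalSpace X] (D : Set X) : Prop :=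
  IsOpen D ∧ IsConnected D

/-- A continuum: a nonempty connected compact set. -/
def IsContinuum {X : Type*} [TopologicalSpace X] (K : Set X) : Prop :=
  IsCompact K ∧ IsConnected K

/-- The family `Γ(A, B, D)` of paths `γ : [0, 1] → X` with `γ(0) ∈ A`, `γ(1) ∈ B` and
`γ(t) ∈ D` for `0 < t < 1`. A path is represented by a function on `ℝ`, of which only the
restriction to `[0, 1]` matters. -/
def connectingPaths {X : Type*} [TopologicalSpace X] (A B D : Set X) : Set (ℝ → X) :=
  {γ | ContinuousOn γ (Icc 0 1) ∧ γ 0 ∈ A ∧ γ 1 ∈ B ∧ ∀ t ∈ Ioo (0 : ℝ) 1, γ t ∈ D}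

/-- The integral `∫_c ρ ds` along a locally rectifiable path `c : J → ℝⁿ`, where `J` is an
interval: the supremum over the closed subpaths `c|[a, b]` of the integral of `ρ` over the
arc length parametrization of `c|[a, b]`. -/
def pathIntegral {n : ℕ} (ρ : EuclideanSpace ℝ (Fin n) → ℝ≥0∞) (J : Set ℝ)
    (c : ℝ → EuclideanSpace ℝ (Fin n)) : ℝ≥0∞ :=
  ⨆ (a ∈ J) (b ∈ J) (_ : a ≤ b),
    ∫⁻ s in Icc 0 (variationOnFromTo c J a b), ρ (naturalParameterization c J a s)

/-- `ρ` is admissible for the family `Γ` of paths `γ : J → ℝⁿ ∪ {∞}`: it is a Borel function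
`ℝⁿ → [0, ∞]` with `∫_γ ρ ds ≥ 1` for all locally rectifiable `γ ∈ Γ`. Paths through `∞` are
not locally rectifiable. -/
def IsAdmissible {n : ℕ} (J : Set ℝ) (Γ : Set (ℝ → OnePoint (EuclideanSpace ℝ (Fin n))))
    (ρ : EuclideanSpace ℝ (Fin n) → ℝ≥0∞) : Prop :=
  Measurable ρ ∧ ∀ γ ∈ Γ, ∀ c : ℝ → EuclideanSpace ℝ (Fin n),
    (∀ t ∈ J, γ t = (c t : OnePoint (EuclideanSpace ℝ (Fin n)))) →
    LocallyBoundedVariationOn c J → 1 ≤ pathIntegral ρ J c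

/-- The (conformal) modulus `M(Γ)` of a family of paths `γ : J → ℝⁿ ∪ {∞}`. -/
def modulus {n : ℕ} (J : Set ℝ) (Γ : Set (ℝ → OnePoint (EuclideanSpace ℝ (Fin n)))) : ℝ≥0∞ :=
  ⨅ (ρ : EuclideanSpace ℝ (Fin n) → ℝ≥0∞) (_ : IsAdmissible J Γ ρ), ∫⁻ x, ρ x ^ n

/-- `f` satisfies the ring `Q`-inequality at `x₀` in `D`. The paths of `Γ(S₁, S₂, D)` may have
their end points outside `D`, so the image of such a path is the path `f ∘ γ` on `(0, 1)`. -/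
def IsRingMapAt {n : ℕ} (Q : EuclideanSpace ℝ (Fin n) → ℝ≥0∞)
    (D : Set (EuclideanSpace ℝ (Fin n)))
    (f : EuclideanSpace ℝ (Fin n) → OnePoint (EuclideanSpace ℝ (Fin n)))
    (x₀ : EuclideanSpace ℝ (Fin n)) : Prop :=
  ∀ r₁ r₂ : ℝ, 0 < r₁ → r₁ < r₂ → ENNReal.ofReal r₂ < ⨆ x ∈ D, edist x x₀ →
    ∀ η : ℝ → ℝ≥0∞, AEMeasurable η (volume.restrict (Ioo r₁ r₂)) →
      1 ≤ ∫⁻ r in Ioo r₁ r₂, η r →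
      modulus (Ioo 0 1)
          ((fun γ : ℝ → EuclideanSpace ℝ (Fin n) => f ∘ γ) ''
            connectingPaths (Metric.sphere x₀ r₁) (Metric.sphere x₀ r₂) D)
        ≤ ∫⁻ x in {x | r₁ < dist x x₀ ∧ dist x x₀ < r₂} ∩ D, Q x * η (dist x x₀) ^ n

/-- `f` maps `D` homeomorphically onto `D'` and is a ring `Q`-mapping at every point of `D`.
Only the restriction of `f` to `D` matters. -/
structure IsRingHomeoOnto {n : ℕ} (Q : EuclideanSpace ℝ (Fin n) → ℝ≥0∞)
    (D : Set (EuclideanSpace ℝ (Fin n))) (D' : Set (OnePoint (EuclideanSpace ℝ (Fin n))))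
    (f : EuclideanSpace ℝ (Fin n) → OnePoint (EuclideanSpace ℝ (Fin n))) : Prop where
  isEmbedding : IsEmbedding (D.domRestrict f)
  image_eq : f '' D = D'
  isRingMapAt : ∀ x₀ ∈ D, IsRingMapAt Q D f x₀

/-- `D` is locally connected at `x₀ ∈ closure D`. -/
def IsLocallyConnectedAt {X : Type*} [TopologicalSpace X] (D : Set X) (x₀ : X) : Prop :=
  ∀ U ∈ 𝓝 x₀, ∃ V ∈ 𝓝 x₀, V ⊆ U ∧ IsConnected (V ∩ D)

/-- The boundary of `D ⊆ ℝⁿ ∪ {∞}` is weakly flat at every one of its points. -/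
def HasWeaklyFlatBoundary {n : ℕ} (D : Set (OnePoint (EuclideanSpace ℝ (Fin n)))) : Prop :=
  ∀ x₀ ∈ frontier D, ∀ P : ℝ, 0 < P → ∀ U ∈ 𝓝 x₀, ∃ V ∈ 𝓝 x₀, V ⊆ U ∧
    ∀ E F : Set (OnePoint (EuclideanSpace ℝ (Fin n))),
      IsContinuum E → IsContinuum F → E ⊆ D → F ⊆ D →
      (E ∩ frontier U).Nonempty → (E ∩ frontier V).Nonempty →
      (F ∩ frontier U).Nonempty → (F ∩ frontier V).Nonempty →
      ENNReal.ofReal P < modulus (Icc 0 1) (connectingPaths E F D)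

end

/-!
Suppose that some images `f m '' A` come arbitrarily close to a point `y₀ ∈ ∂D'`. Two opposite
bounds on the modulus of the paths in `D'` that join `f m '' A` to a second continuum `F` then
collide.

*Upper bound.* Let `B ⊆ D` be a compact neighbourhood of `A`. A path from `A` to a point off `B`
crosses one of finitely many spherical rings centred on `A`, and there the ring `Q`-inequality with
constant `η` bounds the modulus of the image family by a multiple of `∫ Q`. Hence the paths from
`f m '' A` to any `F ⊆ D' \ f m '' B` have modulus at most a constant `P` that depends neither on
`m` nor on `F` (`exists_compact_modulus_le`).

*Lower bound.* Let `U` be a neighbourhood of `y₀` of chordal diameter less than `δ` whose closure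
omits a second point `y₁` of the component `K` of `∂D'` through `y₀`, and let `V` be the smaller
neighbourhood that weak flatness provides for `P + 1`. Some `f m '' A` meets `V` and is too large
for `U`, so it meets both boundaries. It remains to find a continuum `F` in `D' \ f m '' B` from
near `y₀` to near `y₁`; then the modulus exceeds `P`, a contradiction.

*The continuum `F`.* Write `C = f m '' B`, a compact subset of `D'`. Near each boundary point `y`,
any two points of `D'` are joined by a path in `D' \ C` (`exists_nhds_joinedIn`): otherwise the
initial pieces of paths from those two points to `C` would be continua near `y` that are connected
in `D'` only by paths reaching `C`. These have bounded modulus, because they cross a fixed ring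
around `y` (`exists_nhds_modulus_le`), and this contradicts weak flatness. As `K` is connected, the
local statement propagates along `K` from `y₀` to `y₁` (`exists_joinedIn_of_isPreconnected`).

The moduli are compared through admissible functions, which requires that the arc length
parametrization of a continuous path runs through the same points as the path: the arc length is a
continuous function of the parameter (`continuousOn_variationOnFromTo`), so it omits no value.
-/

/-! ### Arc length and path integrals -/

/-- The arc length function of a continuous path is continuous: the jumps of the variation are
those of the path. -/
theorem continuousOn_variationOnFromTo {E : Type*} [PseudoMetricSpace E] {c : ℝ → E} {J : Set ℝ}
    (hc : ContinuousOn c J) (hv : LocallyBoundedVariationOn c J) {a : ℝ} (ha : a ∈ J) :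
    ContinuousOn (variationOnFromTo c J a) J := by
  intro b hb
  have hl := variationOnFromTo.tendsto_left ha hb hv
    ((hc b hb).mono_left (nhdsWithin_mono b inter_subset_left))
  have hr := variationOnFromTo.tendsto_right ha hb hv
    ((hc b hb).mono_left (nhdsWithin_mono b inter_subset_left))
  rw [dist_self, sub_zero] at hl
  rw [dist_self, add_zero] at hr
  have h1 : ContinuousWithinAt (variationOnFromTo c J a) (J ∩ Iio b) b := hl
  have h2 : ContinuousWithinAt (variationOnFromTo c J a) (J ∩ Ioi b) b := hr
  have h3 : ContinuousWithinAt (variationOnFromTo c J a) {b} b := continuousWithinAt_singleton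
  refine ((h1.union h2).union h3).mono fun t ht => ?_
  rcases lt_trichotomy t b with h | h | h
  exacts [Or.inl (Or.inl ⟨ht, h⟩), Or.inr h, Or.inl (Or.inr ⟨ht, h⟩)]

theorem exists_variationOnFromTo_eq {E : Type*} [PseudoMetricSpace E] {c : ℝ → E} {J : Set ℝ}
    (hJ : J.OrdConnected) (hc : ContinuousOn c J) (hv : LocallyBoundedVariationOn c J) {a b : ℝ}
    (ha : a ∈ J) (hb : b ∈ J) (hab : a ≤ b) {s : ℝ} (hs : s ∈ Icc 0 (variationOnFromTo c J a b)) :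
    ∃ t ∈ Icc a b, variationOnFromTo c J a t = s := by
  have h := intermediate_value_Icc hab
    ((continuousOn_variationOnFromTo hc hv ha).mono (hJ.out ha hb))
  rw [variationOnFromTo.self] at h
  exact h hs

theorem naturalParameterization_variationOnFromTo {E : Type*} [MetricSpace E] {c : ℝ → E}
    {J : Set ℝ} (hv : LocallyBoundedVariationOn c J) {a t : ℝ} (ha : a ∈ J) (ht : t ∈ J) :
    naturalParameterization c J a (variationOnFromTo c J a t) = c t :=
  edist_eq_zero.1 (edist_naturalParameterization_eq_zero hv ha ht)

section Modulus

variable {n : ℕ}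

theorem pathIntegral_mono {ρ σ : EuclideanSpace ℝ (Fin n) → ℝ≥0∞} (h : ρ ≤ σ) (J : Set ℝ)
    (c : ℝ → EuclideanSpace ℝ (Fin n)) : pathIntegral ρ J c ≤ pathIntegral σ J c :=
  iSup₂_mono fun _ _ => iSup₂_mono fun _ _ => iSup_mono fun _ => lintegral_mono fun _ => h _

/-- The path integral over a monotonically reparametrized subpath is at most the path integral
over the whole path. -/
theorem pathIntegral_comp_le (ρ : EuclideanSpace ℝ (Fin n) → ℝ≥0∞) {I J : Set ℝ}
    (hI : I.OrdConnected) (hJ : J.OrdConnected) {c : ℝ → EuclideanSpace ℝ (Fin n)}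
    (hc : ContinuousOn c J) (hv : LocallyBoundedVariationOn c J) {φ : ℝ → ℝ}
    (hφ : MonotoneOn φ I) (hφc : ContinuousOn φ I) (hφJ : MapsTo φ I J) :
    pathIntegral ρ I (c ∘ φ) ≤ pathIntegral ρ J c := by
  have himg : (φ '' I).OrdConnected := (hI.isPreconnected.image φ hφc).ordConnected
  have hvφ : LocallyBoundedVariationOn (c ∘ φ) I := by
    intro a b ha hb
    refine ne_top_of_le_ne_top (hv (φ a) (φ b) (hφJ ha) (hφJ hb)) ?_
    refine eVariationOn.comp_le_of_monotoneOn c φ (hφ.mono inter_subset_left) fun t ht => ?_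
    exact ⟨hφJ ht.1, hφ ha ht.1 ht.2.1, hφ ht.1 hb ht.2.2⟩
  have hV : ∀ a ∈ I, ∀ b ∈ I, a ≤ b →
      variationOnFromTo (c ∘ φ) I a b = variationOnFromTo c J (φ a) (φ b) := by
    intro a ha b hb hab
    rw [variationOnFromTo.comp_eq_of_monotoneOn c φ hφ ha hb,
      variationOnFromTo.eq_of_le _ _ (hφ ha hb hab), variationOnFromTo.eq_of_le _ _ (hφ ha hb hab),
      inter_eq_right.2 (himg.out ⟨a, ha, rfl⟩ ⟨b, hb, rfl⟩),
      inter_eq_right.2 (hJ.out (hφJ ha) (hφJ hb))]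
  refine iSup₂_le fun a ha => iSup₂_le fun b hb => iSup_le fun hab => ?_
  refine le_trans (le_of_eq ?_) (le_iSup₂_of_le (φ a) (hφJ ha)
    (le_iSup₂_of_le (φ b) (hφJ hb) (le_iSup_of_le (hφ ha hb hab) le_rfl)))
  rw [← hV a ha b hb hab]
  refine setLIntegral_congr_fun measurableSet_Icc fun s hs => ?_
  obtain ⟨t, ht, rfl⟩ := exists_variationOnFromTo_eq hI (hc.comp hφc hφJ) hvφ ha hb hab hs
  have htI : t ∈ I := hI.out ha hb ht
  rw [naturalParameterization_variationOnFromTo hvφ ha htI, hV a ha t htI ht.1,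
    naturalParameterization_variationOnFromTo hv (hφJ ha) (hφJ htI), Function.comp_apply]

/-- A subpath inside `K` has at least the length of its chord, so it contributes at least `κ` times
that to the path integral of `κ` times the indicator function of `K`. -/
theorem mul_edist_le_pathIntegral_indicator (K : Set (EuclideanSpace ℝ (Fin n))) (κ : ℝ≥0∞)
    {J : Set ℝ} (hJ : J.OrdConnected) {c : ℝ → EuclideanSpace ℝ (Fin n)}
    (hc : ContinuousOn c J) (hv : LocallyBoundedVariationOn c J) {a b : ℝ} (ha : a ∈ J)
    (hb : b ∈ J) (hab : a ≤ b) (hK : ∀ t ∈ Icc a b, c t ∈ K) :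
    κ * edist (c a) (c b) ≤ pathIntegral (K.indicator fun _ => κ) J c := by
  refine le_trans ?_ (le_iSup₂_of_le a ha (le_iSup₂_of_le b hb (le_iSup_of_le hab le_rfl)))
  have h : ∀ s ∈ Icc 0 (variationOnFromTo c J a b),
      K.indicator (fun _ => κ) (naturalParameterization c J a s) = κ := by
    intro s hs
    obtain ⟨t, ht, rfl⟩ := exists_variationOnFromTo_eq hJ hc hv ha hb hab hs
    rw [naturalParameterization_variationOnFromTo hv ha (hJ.out ha hb ht),
      indicator_of_mem (hK t ht)]
  rw [setLIntegral_congr_fun measurableSet_Icc h, setLIntegral_const, Real.volume_Icc, sub_zero,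
    variationOnFromTo.eq_of_le _ _ hab, ENNReal.ofReal_toReal (hv a b ha hb)]
  gcongr
  exact eVariationOn.edist_le c ⟨ha, le_rfl, hab⟩ ⟨hb, hab, le_rfl⟩

/-! ### Estimates for the modulus -/

theorem exists_isAdmissible_lt {J : Set ℝ} {Γ : Set (ℝ → OnePoint (EuclideanSpace ℝ (Fin n)))}
    {a : ℝ≥0∞} (h : modulus J Γ < a) : ∃ ρ, IsAdmissible J Γ ρ ∧ ∫⁻ x, ρ x ^ n < a := by
  obtain ⟨ρ, h⟩ := iInf_lt_iff.1 h
  obtain ⟨hρ, h⟩ := iInf_lt_iff.1 h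
  exact ⟨ρ, hρ, h⟩

theorem modulus_le_lintegral {J : Set ℝ} {Γ : Set (ℝ → OnePoint (EuclideanSpace ℝ (Fin n)))}
    {ρ : EuclideanSpace ℝ (Fin n) → ℝ≥0∞} (h : IsAdmissible J Γ ρ) :
    modulus J Γ ≤ ∫⁻ x, ρ x ^ n :=
  iInf₂_le ρ h

/-- If a path in `ℝⁿ ∪ {∞}` avoids `∞`, its lift to `ℝⁿ` is continuous. -/
theorem continuousOn_of_coe {c : ℝ → EuclideanSpace ℝ (Fin n)} {J : Set ℝ}
    {γ : ℝ → OnePoint (EuclideanSpace ℝ (Fin n))} (hγ : ContinuousOn γ J)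
    (h : ∀ t ∈ J, γ t = (c t : OnePoint (EuclideanSpace ℝ (Fin n)))) : ContinuousOn c J := by
  rw [OnePoint.isOpenEmbedding_coe.isInducing.continuousOn_iff]
  exact hγ.congr fun t ht => (h t ht).symm

/-- Minorization and subadditivity of the modulus: if every path of `Γ` has a subpath in one of
finitely many families `Γ' i`, then `M(Γ) ≤ ∑ᵢ M(Γ' i)`. -/
theorem modulus_le_sum_of_subpaths {ι : Type*} (hn : n ≠ 0) (s : Finset ι)
    {Γ : Set (ℝ → OnePoint (EuclideanSpace ℝ (Fin n)))} {J : Set ℝ} (hJ : J.OrdConnected)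
    {I : Set ℝ} (hI : I.OrdConnected)
    (Γ' : ι → Set (ℝ → OnePoint (EuclideanSpace ℝ (Fin n))))
    (hΓ : ∀ γ ∈ Γ, ContinuousOn γ J)
    (h : ∀ γ ∈ Γ, ∃ i ∈ s, ∃ γ' ∈ Γ' i, ∃ φ : ℝ → ℝ, MonotoneOn φ I ∧ ContinuousOn φ I ∧
      MapsTo φ I J ∧ EqOn γ' (γ ∘ φ) I) :
    modulus J Γ ≤ ∑ i ∈ s, modulus I (Γ' i) := by
  rcases eq_or_ne (∑ i ∈ s, modulus I (Γ' i)) ∞ with htop | htop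
  · rw [htop]; exact le_top
  refine ENNReal.le_of_forall_pos_le_add fun ε hε _ => ?_
  have hfin : ∀ i ∈ s, modulus I (Γ' i) ≠ ∞ := fun i hi => (ENNReal.sum_ne_top.1 htop) i hi
  have hδ : (ε : ℝ≥0∞) / (s.card + 1 : ℝ≥0∞) ≠ 0 :=
    (ENNReal.div_pos (by exact_mod_cast hε.ne') (by finiteness)).ne'
  have hex : ∀ i ∈ s, ∃ ρ, IsAdmissible I (Γ' i) ρ ∧
      ∫⁻ x, ρ x ^ n < modulus I (Γ' i) + ε / (s.card + 1 : ℝ≥0∞) := fun i hi =>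
    exists_isAdmissible_lt (ENNReal.lt_add_right (hfin i hi) hδ)
  choose! ρ hρ hρi using hex
  have hadm : IsAdmissible J Γ fun x => ⨆ i ∈ s, ρ i x := by
    refine ⟨Measurable.biSup _ s.countable_toSet fun i hi => (hρ i hi).1, fun γ hγ c hc hv => ?_⟩
    obtain ⟨i, hi, γ', hγ', φ, hφ, hφc, hφJ, heq⟩ := h γ hγ
    have hcc : ContinuousOn c J := continuousOn_of_coe (hΓ γ hγ) hc
    calc (1 : ℝ≥0∞) ≤ pathIntegral (ρ i) I (c ∘ φ) := by
          refine (hρ i hi).2 γ' hγ' _ (fun t ht => ?_) fun a b ha hb => ?_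
          · rw [heq ht]; exact hc _ (hφJ ht)
          · refine ne_top_of_le_ne_top (hv (φ a) (φ b) (hφJ ha) (hφJ hb)) ?_
            refine eVariationOn.comp_le_of_monotoneOn c φ (hφ.mono inter_subset_left)
              fun t ht => ?_
            exact ⟨hφJ ht.1, hφ ha ht.1 ht.2.1, hφ ht.1 hb ht.2.2⟩
      _ ≤ pathIntegral (ρ i) J c := pathIntegral_comp_le _ hI hJ hcc hv hφ hφc hφJ
      _ ≤ pathIntegral (fun x => ⨆ i ∈ s, ρ i x) J c :=
          pathIntegral_mono
            (fun x => le_iSup₂_of_le (f := fun i (_ : i ∈ s) => ρ i x) i hi le_rfl) J c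
  calc modulus J Γ ≤ ∫⁻ x, (⨆ i ∈ s, ρ i x) ^ n := modulus_le_lintegral hadm
    _ ≤ ∫⁻ x, ∑ i ∈ s, ρ i x ^ n := by
        refine lintegral_mono fun x => ?_
        rcases s.eq_empty_or_nonempty with rfl | hs
        · simp [hn]
        · obtain ⟨i, hi, hmax⟩ := s.exists_max_image (fun i => ρ i x) hs
          calc (⨆ i ∈ s, ρ i x) ^ n ≤ ρ i x ^ n := by gcongr; exact iSup₂_le hmax
            _ ≤ _ := Finset.single_le_sum (f := fun i => ρ i x ^ n) (fun _ _ => zero_le) hi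
    _ = ∑ i ∈ s, ∫⁻ x, ρ i x ^ n :=
        lintegral_finsetSum' _ fun i hi => ((hρ i hi).1.pow_const n).aemeasurable
    _ ≤ ∑ i ∈ s, (modulus I (Γ' i) + ε / (s.card + 1 : ℝ≥0∞)) :=
        Finset.sum_le_sum fun i hi => (hρi i hi).le
    _ = ∑ i ∈ s, modulus I (Γ' i) + s.card * (ε / (s.card + 1 : ℝ≥0∞)) := by
        rw [Finset.sum_add_distrib, Finset.sum_const, nsmul_eq_mul]
    _ ≤ ∑ i ∈ s, modulus I (Γ' i) + ε := by
        gcongr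
        calc (s.card : ℝ≥0∞) * (ε / (s.card + 1 : ℝ≥0∞))
            ≤ (s.card + 1 : ℝ≥0∞) * (ε / (s.card + 1 : ℝ≥0∞)) := by gcongr; exact le_self_add
          _ ≤ ε := ENNReal.mul_div_le

/-- A continuous function that rises from at most `α` to at least `β` reaches `β` at the end of an
initial segment on which it stays below `β`. -/
theorem exists_first_crossing {g : ℝ → ℝ} {a b β : ℝ} (hab : a ≤ b)
    (hg : ContinuousOn g (Icc a b)) (ha : g a ≤ β) (hb : β ≤ g b) :
    ∃ t ∈ Icc a b, g t = β ∧ ∀ s ∈ Icc a t, g s ≤ β := by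
  have hK : IsCompact (Icc a b ∩ g ⁻¹' {β}) :=
    isCompact_Icc.of_isClosed_subset (hg.preimage_isClosed_of_isClosed isClosed_Icc
      isClosed_singleton) inter_subset_left
  have hne : (Icc a b ∩ g ⁻¹' {β}).Nonempty := by
    obtain ⟨t, ht, h⟩ := intermediate_value_Icc hab hg ⟨ha, hb⟩
    exact ⟨t, ht, h⟩
  obtain ⟨t, ⟨ht, hgt⟩, hmin⟩ := hK.exists_isLeast hne
  refine ⟨t, ht, hgt, fun s hs => ?_⟩
  by_contra! hlt
  obtain ⟨u, hu, hgu⟩ := intermediate_value_Icc hs.1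
    (hg.mono (Icc_subset_Icc_right (hs.2.trans ht.2))) ⟨ha, hlt.le⟩
  have htu : t ≤ u := hmin ⟨⟨hu.1, hu.2.trans (hs.2.trans ht.2)⟩, hgu⟩
  have : s = t := le_antisymm hs.2 (htu.trans hu.2)
  rw [this, hgt] at hlt
  exact lt_irrefl _ hlt

theorem exists_last_crossing {g : ℝ → ℝ} {a b β : ℝ} (hab : a ≤ b)
    (hg : ContinuousOn g (Icc a b)) (ha : β ≤ g a) (hb : g b ≤ β) :
    ∃ t ∈ Icc a b, g t = β ∧ ∀ s ∈ Icc t b, g s ≤ β := by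
  have hg' : ContinuousOn (fun u => g (-u)) (Icc (-b) (-a)) :=
    hg.comp continuousOn_neg fun u hu => ⟨le_neg.1 hu.2, neg_le.1 hu.1⟩
  obtain ⟨t, ht, hgt, h⟩ := exists_first_crossing (neg_le_neg hab) hg' (by simpa using hb)
    (by simpa using ha)
  refine ⟨-t, ⟨le_neg.1 ht.2, neg_le.1 ht.1⟩, hgt, fun s hs => ?_⟩
  simpa using h (-s) ⟨neg_le_neg hs.2, neg_le.1 hs.1⟩

/-- The density `1 / r` on the ball of radius `2 * r` is admissible for the paths that cross the ring
of radii `r` and `2 * r`, in either direction. -/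
theorem one_le_pathIntegral_of_crossing (x : EuclideanSpace ℝ (Fin n)) {r : ℝ} (hr : 0 < r)
    {c : ℝ → EuclideanSpace ℝ (Fin n)} {J : Set ℝ} (hJ : J.OrdConnected)
    (hc : ContinuousOn c J) (hv : LocallyBoundedVariationOn c J) {a b : ℝ} (ha : a ∈ J)
    (hb : b ∈ J) (hab : a ≤ b)
    (h : (dist (c a) x ≤ r ∧ 2 * r ≤ dist (c b) x) ∨ (2 * r ≤ dist (c a) x ∧ dist (c b) x ≤ r)) :
    1 ≤ pathIntegral ((Metric.closedBall x (2 * r)).indicator fun _ => ENNReal.ofReal r⁻¹) J c := by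
  have hg : ContinuousOn (fun t => dist (c t) x) (Icc a b) := by
    have := hc.mono (hJ.out ha hb)
    fun_prop
  have key : ∀ u v : EuclideanSpace ℝ (Fin n), r ≤ dist u v →
      1 ≤ ENNReal.ofReal r⁻¹ * edist u v := by
    intro u v huv
    rw [edist_dist, ← ENNReal.ofReal_mul (by positivity), ENNReal.one_le_ofReal]
    calc (1 : ℝ) = r⁻¹ * r := (inv_mul_cancel₀ hr.ne').symm
      _ ≤ _ := by gcongr
  rcases h with ⟨h1, h2⟩ | ⟨h1, h2⟩
  · obtain ⟨t, ht, hgt, hle⟩ := exists_first_crossing hab hg (by linarith) h2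
    refine (key (c a) (c t) ?_).trans (mul_edist_le_pathIntegral_indicator _ _ hJ hc hv ha
      (hJ.out ha hb ht) ht.1 hle)
    have := dist_triangle_left (c t) x (c a)
    linarith
  · obtain ⟨t, ht, hgt, hle⟩ := exists_last_crossing hab hg h1 (by linarith)
    refine (key (c t) (c b) ?_).trans (mul_edist_le_pathIntegral_indicator _ _ hJ hc hv
      (hJ.out ha hb ht) hb ht.2 hle)
    have := dist_triangle (c t) (c b) x
    linarith

/-- Every point `y` off a closed set `C` has a neighbourhood `U` such that the paths that start in
the closure of `U` and meet `C` have uniformly bounded modulus. For `y = ∞` the ring around `y` is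
the exterior of a ball. -/
theorem exists_nhds_modulus_le (hn : n ≠ 0) (y : OnePoint (EuclideanSpace ℝ (Fin n)))
    {C : Set (OnePoint (EuclideanSpace ℝ (Fin n)))} (hC : IsClosed C) (hy : y ∉ C) :
    ∃ U, IsOpen U ∧ y ∈ U ∧ Disjoint (closure U) C ∧ ∃ P : ℝ≥0∞, P ≠ ∞ ∧
      ∀ Γ : Set (ℝ → OnePoint (EuclideanSpace ℝ (Fin n))),
        (∀ γ ∈ Γ, ContinuousOn γ (Icc 0 1) ∧ γ 0 ∈ closure U ∧ ∃ t ∈ Icc (0 : ℝ) 1, γ t ∈ C) →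
        modulus (Icc 0 1) Γ ≤ P := by
  suffices H : ∃ U, IsOpen U ∧ y ∈ U ∧ Disjoint (closure U) C ∧
      ∃ (x : EuclideanSpace ℝ (Fin n)) (r : ℝ), 0 < r ∧
        ∀ p q : EuclideanSpace ℝ (Fin n), (p : OnePoint (EuclideanSpace ℝ (Fin n))) ∈ closure U →
          (q : OnePoint (EuclideanSpace ℝ (Fin n))) ∈ C →
          (dist p x ≤ r ∧ 2 * r ≤ dist q x) ∨ (2 * r ≤ dist p x ∧ dist q x ≤ r) by
    obtain ⟨U, hU, hyU, hUC, x, r, hr, hpq⟩ := H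
    refine ⟨U, hU, hyU, hUC, ∫⁻ z, (Metric.closedBall x (2 * r)).indicator
      (fun _ => ENNReal.ofReal r⁻¹) z ^ n, ?_, fun Γ hΓ => modulus_le_lintegral
        ⟨measurable_const.indicator Metric.isClosed_closedBall.measurableSet,
          fun γ hγ c hc hv => ?_⟩⟩
    · have h : ∀ z, (Metric.closedBall x (2 * r)).indicator (fun _ => ENNReal.ofReal r⁻¹) z ^ n =
          (Metric.closedBall x (2 * r)).indicator (fun _ => ENNReal.ofReal r⁻¹ ^ n) z := by
        intro z
        by_cases hz : z ∈ Metric.closedBall x (2 * r) <;> simp [indicator, hz, hn]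
      simp_rw [h]
      rw [lintegral_indicator_const Metric.isClosed_closedBall.measurableSet]
      exact ENNReal.mul_ne_top (by finiteness) measure_closedBall_lt_top.ne
    · obtain ⟨hγc, h0, t, ht, htC⟩ := hΓ γ hγ
      have h0' : (0 : ℝ) ∈ Icc (0 : ℝ) 1 := ⟨le_rfl, zero_le_one⟩
      rw [hc 0 h0'] at h0
      rw [hc t ht] at htC
      exact one_le_pathIntegral_of_crossing x hr ordConnected_Icc (continuousOn_of_coe hγc hc) hv
        h0' ht ht.1 (hpq _ _ h0 htC)
  induction y using OnePoint.rec with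
  | infty =>
    -- The closed set `C` misses `∞`, hence it is a bounded subset of `ℝⁿ`.
    have hK : IsCompact (OnePoint.some ⁻¹' C : Set (EuclideanSpace ℝ (Fin n))) :=
      ((OnePoint.isClosed_iff_of_notMem hy).1 hC).2
    obtain ⟨r, hr, hrC⟩ := hK.isBounded.subset_closedBall_lt 0 0
    have hsub : closure (OnePoint.some '' Metric.closedBall (0 : EuclideanSpace ℝ (Fin n)) (2 * r) :
        Set (OnePoint (EuclideanSpace ℝ (Fin n))))ᶜ ⊆ (OnePoint.some '' Metric.ball 0 (2 * r))ᶜ :=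
      closure_minimal (compl_subset_compl.2 (image_mono Metric.ball_subset_closedBall))
        (OnePoint.isOpen_image_coe.2 Metric.isOpen_ball).isClosed_compl
    refine ⟨(OnePoint.some '' Metric.closedBall 0 (2 * r))ᶜ, OnePoint.isOpen_compl_image_coe.2
      ⟨Metric.isClosed_closedBall, isCompact_closedBall _ _⟩, OnePoint.infty_notMem_image_coe,
      disjoint_left.2 fun z hz hzC => ?_, 0, r, hr, fun p q hp hq => Or.inr ⟨?_, hrC hq⟩⟩
    · induction z using OnePoint.rec with
      | infty => exact hy hzC
      | coe z =>
        refine hsub hz ⟨z, ?_, rfl⟩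
        have : dist z 0 ≤ r := hrC hzC
        rw [Metric.mem_ball]
        linarith
    · by_contra! hlt
      exact hsub hp ⟨p, hlt, rfl⟩
  | coe x =>
    have hO : OnePoint.some ⁻¹' Cᶜ ∈ 𝓝 x :=
      (hC.isOpen_compl.preimage OnePoint.continuous_coe).mem_nhds hy
    obtain ⟨ε, hε, hεC⟩ := Metric.mem_nhds_iff.1 hO
    have hsub : closure (OnePoint.some '' Metric.ball x (ε / 2) :
        Set (OnePoint (EuclideanSpace ℝ (Fin n)))) ⊆ OnePoint.some '' Metric.closedBall x (ε / 2) :=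
      closure_minimal (image_mono Metric.ball_subset_closedBall)
        (OnePoint.isClosed_image_coe.2 ⟨Metric.isClosed_closedBall, isCompact_closedBall _ _⟩)
    refine ⟨OnePoint.some '' Metric.ball x (ε / 2), OnePoint.isOpen_image_coe.2 Metric.isOpen_ball,
      ⟨x, Metric.mem_ball_self (by positivity), rfl⟩, disjoint_left.2 fun z hz hzC => ?_, x, ε / 2,
      by positivity, fun p q hp hq => Or.inl ⟨?_, ?_⟩⟩
    · obtain ⟨w, hw, rfl⟩ := hsub hz
      rw [Metric.mem_closedBall] at hw
      exact hεC (show dist w x < ε by linarith) hzC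
    · obtain ⟨w, hw, hwp⟩ := hsub hp
      rwa [← OnePoint.coe_injective hwp]
    · by_contra! hlt
      exact hεC (show dist q x < ε by linarith) hq

/-! ### Joining points of `D'` near its boundary -/

theorem IsPreconnected.nonempty_inter_frontier {X : Type*} [TopologicalSpace X] {E U : Set X}
    (hE : IsPreconnected E) (h1 : (E ∩ U).Nonempty) (h2 : (E ∩ Uᶜ).Nonempty) :
    (E ∩ frontier U).Nonempty := by
  by_contra hne
  have hfr : ∀ x ∈ E, x ∉ frontier U := fun x hx hxU => hne ⟨x, hx, hxU⟩
  have hin : ∀ x ∈ E, x ∈ U → x ∈ interior U := fun x hx hxU => by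
    by_contra h
    exact hfr x hx ⟨subset_closure hxU, h⟩
  have hout : ∀ x ∈ E, x ∉ U → x ∈ (closure U)ᶜ := fun x hx hxU h =>
    hfr x hx ⟨h, fun h' => hxU (interior_subset h')⟩
  obtain ⟨x, -, hx1, hx2⟩ := hE (interior U) (closure U)ᶜ isOpen_interior
    isClosed_closure.isOpen_compl
    (fun x hx => (em (x ∈ U)).imp (hin x hx) (hout x hx))
    (h1.imp fun x hx => ⟨hx.1, hin x hx.1 hx.2⟩) (h2.imp fun x hx => ⟨hx.1, hout x hx.1 hx.2⟩)
  exact hx2 (subset_closure (interior_subset hx1))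

/-- The initial piece, up to the first exit from `U`, of a path that leaves the open set `U`. -/
theorem exists_isPathConnected_inter_frontier {X : Type*} [TopologicalSpace X] {D U : Set X}
    (hU : IsOpen U) {p q : X} (hp : p ∈ U) (hq : q ∉ U) (hpq : JoinedIn D p q) :
    ∃ E ⊆ D ∩ closure U, IsCompact E ∧ IsPathConnected E ∧ p ∈ E ∧ (E ∩ frontier U).Nonempty := by
  obtain ⟨γ, hγ⟩ := hpq
  have hc : Continuous γ.extend := γ.continuous_extend
  have hK : IsCompact (Icc (0 : ℝ) 1 ∩ γ.extend ⁻¹' Uᶜ) :=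
    isCompact_Icc.inter_right (hU.isClosed_compl.preimage hc)
  obtain ⟨t, ⟨ht, htU⟩, hmin⟩ := hK.exists_isLeast ⟨1, ⟨zero_le_one, le_rfl⟩, by simpa using hq⟩
  have hlt : ∀ s ∈ Ico 0 t, γ.extend s ∈ U := fun s hs => by
    by_contra h
    exact absurd (hmin ⟨⟨hs.1, hs.2.le.trans ht.2⟩, h⟩) (not_le.2 hs.2)
  have ht0 : t ≠ 0 := by
    rintro rfl
    exact htU (by simpa using hp)
  have hcl : ∀ s ∈ Icc 0 t, γ.extend s ∈ closure U := by
    rw [← closure_Ico ht0.symm]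
    exact MapsTo.closure hlt hc
  refine ⟨γ.extend '' Icc 0 t, ?_, isCompact_Icc.image hc, ?_, ⟨0, ⟨le_rfl, ht.1⟩, by simp⟩,
    γ.extend t, ⟨t, ⟨ht.1, le_rfl⟩, rfl⟩, hcl t ⟨ht.1, le_rfl⟩, ?_⟩
  · rintro _ ⟨s, hs, rfl⟩
    refine ⟨?_, hcl s hs⟩
    rw [γ.extend_apply ⟨hs.1, hs.2.trans ht.2⟩]
    exact hγ _
  · exact ((convex_Icc 0 t).isPathConnected ⟨0, le_rfl, ht.1⟩).image hc
  · rw [hU.interior_eq]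
    exact htU

/-- Weak flatness makes `D'` locally connected at its boundary, even relative to the complement of a
compact set `C`: two points near `y` that are not joined off `C` lie on continua that only paths
crossing a fixed ring around `y` connect. -/
theorem exists_nhds_joinedIn (hn : n ≠ 0) {D' : Set (OnePoint (EuclideanSpace ℝ (Fin n)))}
    (hD' : IsOpen D') (hpc : IsPathConnected D') (hflat : HasWeaklyFlatBoundary D')
    {C : Set (OnePoint (EuclideanSpace ℝ (Fin n)))} (hC : IsCompact C) (hCne : C.Nonempty)
    (hCD : C ⊆ D') {y : OnePoint (EuclideanSpace ℝ (Fin n))} (hy : y ∈ frontier D') :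
    ∃ V ∈ 𝓝 y, ∀ p ∈ V ∩ D', ∀ q ∈ V ∩ D', JoinedIn (D' \ C) p q := by
  have hyC : y ∉ C := fun h => by
    rw [hD'.frontier_eq] at hy
    exact hy.2 (hCD h)
  obtain ⟨U, hU, hyU, hUC, P, hP, hmod⟩ := exists_nhds_modulus_le hn y hC.isClosed hyC
  obtain ⟨V, hV, hVU, hflat⟩ := hflat y hy (P.toReal + 1) (by positivity) U (hU.mem_nhds hyU)
  obtain ⟨c₀, hc₀⟩ := hCne
  have hpiece : ∀ p ∈ V ∩ D', ∃ E ⊆ D' ∩ closure U, IsContinuum E ∧ IsPathConnected E ∧ p ∈ E ∧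
      (E ∩ frontier U).Nonempty ∧ (E ∩ frontier V).Nonempty := by
    intro p hp
    obtain ⟨E, hE, hEc, hEp, hpE, e, heE, heU⟩ :=
      exists_isPathConnected_inter_frontier hU (hVU hp.1)
        (fun h => disjoint_left.1 hUC (subset_closure h) hc₀) (hpc.joinedIn p hp.2 c₀ (hCD hc₀))
    refine ⟨E, hE, ⟨hEc, hEp.isConnected⟩, hEp, hpE, ⟨e, heE, heU⟩,
      hEp.isConnected.isPreconnected.nonempty_inter_frontier ⟨p, hpE, hp.1⟩
        ⟨e, heE, fun heV => ?_⟩⟩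
    rw [hU.frontier_eq] at heU
    exact heU.2 (hVU heV)
  have hoff : ∀ E ⊆ D' ∩ closure U, E ⊆ D' \ C := fun E hE x hx =>
    ⟨(hE hx).1, disjoint_left.1 hUC (hE hx).2⟩
  refine ⟨V, hV, fun p hp q hq => ?_⟩
  obtain ⟨E, hE, hEK, hEp, hpE, hEU, hEV⟩ := hpiece p hp
  obtain ⟨F, hF, hFK, hFp, hqF, hFU, hFV⟩ := hpiece q hq
  by_contra hnot
  have hlt := hflat E F hEK hFK (fun x hx => (hE hx).1) (fun x hx => (hF hx).1) hEU hEV hFU hFV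
  refine absurd (hlt.trans_le (hmod _ fun γ hγ => ⟨hγ.1, (hE hγ.2.1).2, ?_⟩)) (not_lt.2 ?_)
  · by_contra! hγC
    have hγD : ∀ t ∈ Icc (0 : ℝ) 1, γ t ∈ D' := by
      intro t ht
      rcases eq_or_lt_of_le ht.1 with rfl | h0
      · exact (hE hγ.2.1).1
      rcases eq_or_lt_of_le ht.2 with rfl | h1
      · exact (hF hγ.2.2.1).1
      exact hγ.2.2.2 t ⟨h0, h1⟩
    have himg : IsPathConnected (γ '' Icc 0 1) :=
      ((convex_Icc (0 : ℝ) 1).isPathConnected ⟨0, le_rfl, zero_le_one⟩).image' hγ.1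
    have h01 : JoinedIn (D' \ C) (γ 0) (γ 1) :=
      (himg.joinedIn _ ⟨0, ⟨le_rfl, zero_le_one⟩, rfl⟩ _ ⟨1, ⟨zero_le_one, le_rfl⟩, rfl⟩).mono
        (by rintro _ ⟨t, ht, rfl⟩; exact ⟨hγD t ht, hγC t ht⟩)
    exact hnot ((((hEp.joinedIn p hpE _ hγ.2.1).mono (hoff E hE)).trans h01).trans
      ((hFp.joinedIn _ hγ.2.2.1 q hqF).mono (hoff F hF)))
  · rw [← ENNReal.ofReal_toReal hP]
    exact ENNReal.ofReal_le_ofReal (by rw [ENNReal.toReal_ofReal ENNReal.toReal_nonneg]; linarith)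

/-- If points of `D'` near each point of a connected boundary set `K` are joined in `S`, then so are
points of `D'` near any two points of `K`. -/
theorem exists_joinedIn_of_isPreconnected {X : Type*} [TopologicalSpace X] {D' S K : Set X}
    (hK : IsPreconnected K) (hKD : K ⊆ closure D')
    (hloc : ∀ y ∈ K, ∃ V ∈ 𝓝 y, ∀ p ∈ V ∩ D', ∀ q ∈ V ∩ D', JoinedIn S p q)
    {y z : X} (hy : y ∈ K) (hz : z ∈ K) :
    ∃ V ∈ 𝓝 y, ∃ W ∈ 𝓝 z, ∀ p ∈ V ∩ D', ∀ q ∈ W ∩ D', JoinedIn S p q := by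
  refine hK.induction₂ (fun y z => ∃ V ∈ 𝓝 y, ∃ W ∈ 𝓝 z, ∀ p ∈ V ∩ D', ∀ q ∈ W ∩ D',
    JoinedIn S p q) (fun x hx => ?_) ?_ ?_ hy hz
  · obtain ⟨V, hV, h⟩ := hloc x hx
    filter_upwards [mem_nhdsWithin_of_mem_nhds (eventually_mem_nhds_iff.2 hV)] with w hw
    exact ⟨V, hV, V, hw, h⟩
  · rintro x y z - hy - ⟨V, hV, W, hW, h1⟩ ⟨V', hV', W', hW', h2⟩
    obtain ⟨q, hq, hqD⟩ := mem_closure_iff_nhds.1 (hKD hy) _ (inter_mem hW hV')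
    exact ⟨V, hV, W', hW', fun p hp r hr => (h1 p hp q ⟨hq.1, hqD⟩).trans (h2 q ⟨hq.2, hqD⟩ r hr)⟩
  · rintro x y - - ⟨V, hV, W, hW, h⟩
    exact ⟨W, hW, V, hV, fun p hp q hq => (h q hq p hp).symm⟩

/-! ### The modulus bound for ring `Q`-homeomorphisms -/

/-- A path in the image of an embedding lifts to a path in the domain. -/
theorem exists_lift_of_isEmbedding {X Y : Type*} [TopologicalSpace X] [TopologicalSpace Y]
    {D : Set X} {f : X → Y} (hf : IsEmbedding (D.domRestrict f)) {γ : ℝ → Y} {a b : ℝ}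
    (hab : a ≤ b) (hγ : ContinuousOn γ (Icc a b)) (hγD : MapsTo γ (Icc a b) (f '' D)) :
    ∃ β : ℝ → X, Continuous β ∧ (∀ t, β t ∈ D) ∧ EqOn (f ∘ β) γ (Icc a b) := by
  have hex : ∀ t : Icc a b, ∃ x : D, f x = γ t := fun t => by
    obtain ⟨x, hx, h⟩ := hγD t.2
    exact ⟨⟨x, hx⟩, h⟩
  choose β hβ using hex
  have hβc : Continuous β := by
    rw [hf.isInducing.continuous_iff]
    exact (continuousOn_iff_continuous_domRestrict.1 hγ).congr fun t => (hβ t).symm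
  refine ⟨fun t => (IccExtend hab β t).1, continuous_subtype_val.comp hβc.Icc_extend',
    fun t => (IccExtend hab β t).2, fun t ht => ?_⟩
  simp only [Function.comp_apply, IccExtend_of_mem hab β ht]
  exact hβ ⟨t, ht⟩

/-- A path in `D` from the ball of radius `r₁` to the exterior of the ball of radius `r₂` has a
subpath, affinely parametrized by `[0, 1]`, that joins the two spheres. -/
theorem exists_subpath_mem_connectingPaths {X : Type*} [PseudoMetricSpace X] {D : Set X}
    {β : ℝ → X} (hβ : Continuous β) (hβD : ∀ t, β t ∈ D) {x : X} {r₁ r₂ : ℝ} (hr : r₁ ≤ r₂)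
    (h0 : dist (β 0) x ≤ r₁) (h1 : r₂ ≤ dist (β 1) x) :
    ∃ φ : ℝ → ℝ, Monotone φ ∧ Continuous φ ∧ MapsTo φ (Icc 0 1) (Icc 0 1) ∧
      β ∘ φ ∈ connectingPaths (Metric.sphere x r₁) (Metric.sphere x r₂) D := by
  have hg : Continuous fun t => dist (β t) x := hβ.dist continuous_const
  obtain ⟨t, ht, hgt⟩ := intermediate_value_Icc zero_le_one hg.continuousOn ⟨h0.trans hr, h1⟩
  obtain ⟨s, hs, hgs⟩ := intermediate_value_Icc ht.1 hg.continuousOn ⟨h0, hr.trans hgt.ge⟩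
  have hst : 0 ≤ t - s := sub_nonneg.2 hs.2
  have hφ : Continuous fun u : ℝ => s + u * (t - s) := by fun_prop
  refine ⟨fun u => s + u * (t - s), fun u v huv => by dsimp only; gcongr, hφ,
    fun u hu => ⟨add_nonneg hs.1 (mul_nonneg hu.1 hst), ?_⟩, (hβ.comp hφ).continuousOn, ?_, ?_,
    fun _ _ => hβD _⟩
  · calc s + u * (t - s) ≤ s + 1 * (t - s) := by gcongr; exact hu.2
      _ = t := by ring
      _ ≤ 1 := ht.2
  · simpa using hgs
  · simpa using hgt

/-- Finitely many balls of radius `ε / 3` cover `A`. A path from `A` to a point at distance more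
than `ε` from `A` crosses the ring of radii `ε / 3` and `2 * ε / 3` around one of their centres, and the
ring `Q`-inequality with constant `η` bounds the modulus of the image of that ring family by
`(3 / ε) ^ n * ∫ Q`, which does not depend on the mapping. -/
theorem exists_compact_modulus_le (hn : n ≠ 0) {D : Set (EuclideanSpace ℝ (Fin n))}
    (hD : IsOpen D) {Q : EuclideanSpace ℝ (Fin n) → ℝ≥0∞} (hQm : AEMeasurable Q volume)
    (hQ : ∫⁻ x in D, Q x < ∞) {A : Set (EuclideanSpace ℝ (Fin n))} (hA : IsCompact A)
    (hAD : A ⊆ D) :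
    ∃ B, IsCompact B ∧ A ⊆ B ∧ B ⊆ D ∧ ∃ P : ℝ≥0∞, P ≠ ∞ ∧
      ∀ D' : Set (OnePoint (EuclideanSpace ℝ (Fin n))), ∀ f, IsRingHomeoOnto Q D D' f →
        ∀ F ⊆ D' \ f '' B, modulus (Icc 0 1) (connectingPaths (f '' A) F D') ≤ P := by
  have : Nonempty (Fin n) := Fin.pos_iff_nonempty.1 (Nat.pos_of_ne_zero hn)
  obtain ⟨ε, hε, hεD⟩ := hA.exists_cthickening_subset_open hD hAD
  obtain ⟨s, hsA, hcov⟩ := hA.elim_nhds_subcover (fun x => Metric.ball x (ε / 3))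
    fun x _ => Metric.ball_mem_nhds x (by positivity)
  set c : ℝ≥0∞ := ENNReal.ofReal (ε / 3)⁻¹ with hc
  refine ⟨Metric.cthickening ε A, hA.cthickening, Metric.self_subset_cthickening A, hεD,
    s.card * ((∫⁻ x in D, Q x) * c ^ n),
    ENNReal.mul_ne_top (by finiteness) (ENNReal.mul_ne_top hQ.ne (by finiteness)), ?_⟩
  intro D' f hf F hF
  have hring : ∀ x ∈ s, modulus (Ioo 0 1)
      ((fun γ : ℝ → EuclideanSpace ℝ (Fin n) => f ∘ γ) ''
        connectingPaths (Metric.sphere x (ε / 3)) (Metric.sphere x (2 * (ε / 3))) D) ≤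
      (∫⁻ x in D, Q x) * c ^ n := by
    intro x hx
    refine (hf.isRingMapAt x (hAD (hsA x hx)) (ε / 3) (2 * (ε / 3)) (by positivity) (by linarith) ?_
      (fun _ => c) aemeasurable_const ?_).trans ?_
    · obtain ⟨z, hz⟩ := NormedSpace.sphere_nonempty (E := EuclideanSpace ℝ (Fin n)) (x := x)
        |>.2 hε.le
      rw [Metric.mem_sphere] at hz
      have hzD : z ∈ D := hεD (Metric.mem_cthickening_of_dist_le z x ε A (hsA x hx) hz.le)
      refine lt_of_lt_of_le ?_ (le_iSup₂_of_le z hzD le_rfl)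
      rw [edist_dist, hz, ENNReal.ofReal_lt_ofReal_iff hε]
      linarith
    · rw [setLIntegral_const, Real.volume_Ioo, hc, ← ENNReal.ofReal_mul (by positivity),
        show 2 * (ε / 3) - ε / 3 = ε / 3 by ring, inv_mul_cancel₀ (by positivity),
        ENNReal.ofReal_one]
    · rw [lintegral_mul_const'' _ hQm.restrict]
      gcongr
      exact inter_subset_right
  calc modulus (Icc 0 1) (connectingPaths (f '' A) F D') ≤ _ := ?_
    _ ≤ ∑ x ∈ s, (∫⁻ x in D, Q x) * c ^ n := Finset.sum_le_sum hring
    _ = _ := by rw [Finset.sum_const, nsmul_eq_mul]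
  refine modulus_le_sum_of_subpaths hn s ordConnected_Icc ordConnected_Ioo _ (fun γ hγ => hγ.1)
    fun γ hγ => ?_
  have hγD : MapsTo γ (Icc 0 1) (f '' D) := by
    rw [hf.image_eq]
    intro t ht
    rcases eq_or_lt_of_le ht.1 with rfl | h0
    · rw [← hf.image_eq]
      exact image_mono hAD hγ.2.1
    rcases eq_or_lt_of_le ht.2 with rfl | h1
    · exact (hF hγ.2.2.1).1
    exact hγ.2.2.2 t ⟨h0, h1⟩
  have h0 : (0 : ℝ) ∈ Icc (0 : ℝ) 1 := ⟨le_rfl, zero_le_one⟩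
  have h1 : (1 : ℝ) ∈ Icc (0 : ℝ) 1 := ⟨zero_le_one, le_rfl⟩
  obtain ⟨β, hβc, hβD, hβγ⟩ := exists_lift_of_isEmbedding hf.isEmbedding zero_le_one hγ.1 hγD
  have hβ0 : β 0 ∈ A := by
    obtain ⟨a, ha, haγ⟩ := hγ.2.1
    have hinj := injOn_iff_injective.2 hf.isEmbedding.injective
    rwa [hinj (hβD 0) (hAD ha) ((hβγ h0).trans haγ.symm)]
  have hβ1 : β 1 ∉ Metric.cthickening ε A := fun h => (hF hγ.2.2.1).2 ⟨β 1, h, hβγ h1⟩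
  obtain ⟨x, hxs, hx⟩ := mem_iUnion₂.1 (hcov hβ0)
  have hfar : 2 * (ε / 3) ≤ dist (β 1) x := by
    by_contra! hlt
    exact hβ1 (Metric.mem_cthickening_of_dist_le _ x ε A (hsA x hxs) (by linarith))
  obtain ⟨φ, hφ, hφc, hφI, hmem⟩ := exists_subpath_mem_connectingPaths hβc hβD
    (by linarith : ε / 3 ≤ 2 * (ε / 3)) (Metric.mem_ball.1 hx).le hfar
  exact ⟨x, hxs, _, ⟨_, hmem, rfl⟩, φ, hφ.monotoneOn _, hφc.continuousOn,
    fun t ht => hφI (Ioo_subset_Icc_self ht), fun t ht => hβγ (hφI (Ioo_subset_Icc_self ht))⟩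

/-! ### The chordal metric -/

theorem chordal_pos {E : Type*} [NormedAddCommGroup E] {p q : OnePoint E}
    (h : p ≠ q) : 0 < chordal p q := by
  induction p using OnePoint.rec with
  | infty =>
    induction q using OnePoint.rec with
    | infty => exact absurd rfl h
    | coe y => change 0 < 1 / √(1 + ‖y‖ ^ 2); positivity
  | coe x =>
    induction q using OnePoint.rec with
    | infty => change 0 < 1 / √(1 + ‖x‖ ^ 2); positivity
    | coe y =>
      have : 0 < ‖x - y‖ := norm_pos_iff.2 (sub_ne_zero.2 fun hxy => h (by rw [hxy]))
      change 0 < ‖x - y‖ / (√(1 + ‖x‖ ^ 2) * √(1 + ‖y‖ ^ 2))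
      positivity

section Chordal

variable {E : Type*} [NormedAddCommGroup E] [InnerProductSpace ℝ E]

/-- Stereographic projection of `E ∪ {∞}` onto the sphere of radius `1 / 2` centred at
`(0, 1 / 2)` in `E × ℝ`, with `∞` going to the origin. -/
noncomputable def stereo (p : OnePoint E) : E × ℝ :=
  p.elim (0, 0) fun x => ((1 + ‖x‖ ^ 2)⁻¹ • x, (1 + ‖x‖ ^ 2)⁻¹)

theorem chordal_eq_sqrt (p q : OnePoint E) :
    chordal p q = √(‖(stereo p).1 - (stereo q).1‖ ^ 2 + ((stereo p).2 - (stereo q).2) ^ 2) := by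
  have hpos : ∀ x : E, 0 < 1 + ‖x‖ ^ 2 := fun x => by positivity
  have hinf : ∀ x : E, 1 / √(1 + ‖x‖ ^ 2) =
      √(‖(1 + ‖x‖ ^ 2)⁻¹ • x‖ ^ 2 + ((1 + ‖x‖ ^ 2)⁻¹) ^ 2) := fun x => by
    rw [one_div, ← Real.sqrt_inv, norm_smul, Real.norm_of_nonneg (inv_nonneg.2 (hpos x).le)]
    congr 1
    have := (hpos x).ne'
    field_simp
    ring
  induction p using OnePoint.rec with
  | infty =>
    induction q using OnePoint.rec with
    | infty => simp [stereo, chordal]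
    | coe y =>
      change 1 / √(1 + ‖y‖ ^ 2) = _
      simp [stereo, hinf y]
  | coe x =>
    induction q using OnePoint.rec with
    | infty =>
      change 1 / √(1 + ‖x‖ ^ 2) = _
      simp [stereo, hinf x]
    | coe y =>
      change ‖x - y‖ / (√(1 + ‖x‖ ^ 2) * √(1 + ‖y‖ ^ 2)) = _
      rw [← Real.sqrt_mul (hpos x).le, ← Real.sqrt_sq (norm_nonneg (x - y)),
        ← Real.sqrt_div (sq_nonneg _)]
      congr 1
      simp only [stereo, OnePoint.elim_some]
      rw [norm_sub_sq_real, norm_sub_sq_real, norm_smul, norm_smul, real_inner_smul_left,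
        real_inner_smul_right, Real.norm_of_nonneg (inv_nonneg.2 (hpos x).le),
        Real.norm_of_nonneg (inv_nonneg.2 (hpos y).le)]
      have := (hpos x).ne'
      have := (hpos y).ne'
      field_simp
      ring

theorem continuous_stereo [ProperSpace E] : Continuous (stereo : OnePoint E → E × ℝ) := by
  have hpos : ∀ x : E, 0 < 1 + ‖x‖ ^ 2 := fun x => by positivity
  rw [OnePoint.continuous_iff]
  have hcont : Continuous fun x : E => (1 + ‖x‖ ^ 2)⁻¹ :=
    (by fun_prop : Continuous fun x : E => 1 + ‖x‖ ^ 2).inv₀ fun x => (hpos x).ne'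
  refine ⟨?_, (hcont.smul continuous_id).prodMk hcont⟩
  rw [coclosedCompact_eq_cocompact]
  have hnorm : Tendsto (fun x : E => ‖x‖) (cocompact E) atTop := tendsto_norm_cocompact_atTop
  have hinv : Tendsto (fun x : E => (1 + ‖x‖ ^ 2)⁻¹) (cocompact E) (𝓝 0) :=
    tendsto_inv_atTop_zero.comp (tendsto_atTop_add_const_left _ _
      ((tendsto_pow_atTop two_ne_zero).comp hnorm))
  refine Tendsto.prodMk_nhds (squeeze_zero_norm (fun x => ?_)
    (tendsto_inv_atTop_zero.comp hnorm)) hinv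
  rw [norm_smul, Real.norm_of_nonneg (inv_nonneg.2 (hpos x).le), Function.comp_apply]
  rcases (norm_nonneg x).eq_or_lt with h | h
  · simp [← h]
  · rw [inv_mul_le_iff₀ (hpos x)]
    field_simp
    linarith

theorem continuous_chordal [ProperSpace E] :
    Continuous fun z : OnePoint E × OnePoint E => chordal z.1 z.2 := by
  simp_rw [chordal_eq_sqrt]
  have := continuous_stereo (E := E)
  fun_prop

theorem chordal_self (p : OnePoint E) : chordal p p = 0 := by simp [chordal_eq_sqrt]

theorem exists_lt_chordalDist [ProperSpace E] {S T : Set (OnePoint E)} (hS : IsCompact S)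
    (hT : IsCompact T) (hTne : T.Nonempty) (h : Disjoint S T) :
    ∃ δ > 0, ∀ S' ⊆ S, S'.Nonempty → δ < chordalDist S' T := by
  rcases S.eq_empty_or_nonempty with rfl | hSne
  · exact ⟨1, one_pos, fun S' hS' hne => absurd (hne.mono hS') not_nonempty_empty⟩
  obtain ⟨z, hz, hmin⟩ := (hS.prod hT).exists_isMinOn (hSne.prod hTne)
    continuous_chordal.continuousOn
  have hpos : 0 < chordal z.1 z.2 := chordal_pos (h.ne_of_mem hz.1 hz.2)
  refine ⟨chordal z.1 z.2 / 2, half_pos hpos, fun S' hS' hne => ?_⟩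
  refine (half_lt_self hpos).trans_le (le_csInf (hne.image2 hTne) ?_)
  rintro _ ⟨p, hp, q, hq, rfl⟩
  exact hmin (mk_mem_prod (hS' hp) hq)

/-- Every point has an open neighbourhood that contains no set of chordal diameter at least `δ`. -/
theorem exists_nhds_not_subset [ProperSpace E] (y : OnePoint E) {δ : ℝ} (hδ : 0 < δ) :
    ∃ U, IsOpen U ∧ y ∈ U ∧ ∀ S : Set (OnePoint E), S.Nonempty → δ ≤ chordalDiam S → ¬S ⊆ U := by
  have h : {z : OnePoint E × OnePoint E | chordal z.1 z.2 < δ / 2} ∈ 𝓝 (y, y) :=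
    (isOpen_lt continuous_chordal continuous_const).mem_nhds
      (by rw [mem_ofPred_eq, chordal_self]; exact half_pos hδ)
  rw [nhds_prod_eq, mem_prod_same_iff] at h
  obtain ⟨W, hW, hWδ⟩ := h
  obtain ⟨U, hUW, hU, hyU⟩ := mem_nhds_iff.1 hW
  refine ⟨U, hU, hyU, fun S hS hSδ hSU => ?_⟩
  have : chordalDiam S ≤ δ / 2 := by
    refine csSup_le (hS.image2 hS) ?_
    rintro _ ⟨p, hp, q, hq, rfl⟩
    exact (hWδ (mk_mem_prod (hUW (hSU hp)) (hUW (hSU hq)))).le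
  linarith

end Chordal

/-! ### Images of the continuum stay away from the boundary -/

theorem IsRingHomeoOnto.continuousOn {Q : EuclideanSpace ℝ (Fin n) → ℝ≥0∞}
    {D : Set (EuclideanSpace ℝ (Fin n))} {D' : Set (OnePoint (EuclideanSpace ℝ (Fin n)))}
    {f : EuclideanSpace ℝ (Fin n) → OnePoint (EuclideanSpace ℝ (Fin n))}
    (hf : IsRingHomeoOnto Q D D' f) : ContinuousOn f D :=
  continuousOn_iff_continuous_domRestrict.2 hf.isEmbedding.continuous

/-- A set homeomorphic to a nonempty open subset of `ℝⁿ` is not all of `ℝⁿ ∪ {∞}`, since `ℝⁿ` has no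
nonempty compact open subsets. -/
theorem frontier_nonempty_of_isRingHomeoOnto (hn : n ≠ 0) {Q : EuclideanSpace ℝ (Fin n) → ℝ≥0∞}
    {D : Set (EuclideanSpace ℝ (Fin n))} (hD : IsOpen D) (hDne : D.Nonempty)
    {D' : Set (OnePoint (EuclideanSpace ℝ (Fin n)))}
    {f : EuclideanSpace ℝ (Fin n) → OnePoint (EuclideanSpace ℝ (Fin n))}
    (hf : IsRingHomeoOnto Q D D' f) : (frontier D').Nonempty := by
  have : Nonempty (Fin n) := Fin.pos_iff_nonempty.1 (Nat.pos_of_ne_zero hn)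
  have : NoncompactSpace (EuclideanSpace ℝ (Fin n)) := NormedSpace.noncompactSpace ℝ _
  rw [nonempty_frontier_iff, ← hf.image_eq]
  refine ⟨hDne.image f, fun huniv => ?_⟩
  have hcpt : IsCompact D := by
    rw [isCompact_iff_isCompact_univ, hf.isEmbedding.isInducing.isCompact_iff, image_univ,
      range_domRestrict, huniv]
    exact isCompact_univ
  have hD1 : D = univ := (isClopen_iff.1 ⟨hcpt.isClosed, hD⟩).resolve_left hDne.ne_empty
  exact noncompact_univ _ (hD1 ▸ hcpt)

end Modulus

theorem lemma3 (n : ℕ) (hn : 2 ≤ n)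
    (D : Set (EuclideanSpace ℝ (Fin n))) (hD : IsDomainSet D) (hDb : Bornology.IsBounded D)
    (hDlc : ∀ x₀ ∈ closure D, IsLocallyConnectedAt D x₀)
    (D' : Set (OnePoint (EuclideanSpace ℝ (Fin n)))) (hD' : IsDomainSet D')
    (hD'flat : HasWeaklyFlatBoundary D')
    (hD'comp : ∀ y ∈ frontier D', (connectedComponentIn (frontier D') y).Nontrivial)
    (Q : EuclideanSpace ℝ (Fin n) → ℝ≥0∞) (hQm : AEMeasurable Q volume)
    (hQ0 : ∀ x, x ∉ D → Q x = 0) (hQ : ∫⁻ x in D, Q x < ∞)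
    (f : ℕ → EuclideanSpace ℝ (Fin n) → OnePoint (EuclideanSpace ℝ (Fin n)))
    (hf : ∀ m, IsRingHomeoOnto Q D D' (f m))
    (A : Set (EuclideanSpace ℝ (Fin n))) (hA : IsContinuum A) (hAD : A ⊆ D)
    (δ : ℝ) (hδ : 0 < δ) (hfA : ∀ m, δ ≤ chordalDiam (f m '' A)) :
    ∃ δ₁ : ℝ, 0 < δ₁ ∧ ∀ m, δ₁ < chordalDist (f m '' A) (frontier D') := by
  have hn0 : n ≠ 0 := by omega
  suffices hdisj : Disjoint (closure (⋃ m, f m '' A)) (frontier D') by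
    obtain ⟨δ₁, hδ₁, h⟩ := exists_lt_chordalDist isClosed_closure.isCompact
      isClosed_frontier.isCompact (frontier_nonempty_of_isRingHomeoOnto hn0 hD.1 hD.2.nonempty
        (hf 0)) hdisj
    exact ⟨δ₁, hδ₁, fun m => h _ ((subset_iUnion (fun m => f m '' A) m).trans subset_closure)
      (hA.2.nonempty.image _)⟩
  rw [disjoint_left]
  intro y₀ hy₀ hy₀D
  obtain ⟨y₁, hy₁, hne⟩ := (hD'comp y₀ hy₀D).exists_ne y₀
  obtain ⟨U₁, hU₁, hy₀U₁, hsmall⟩ := exists_nhds_not_subset y₀ hδ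
  obtain ⟨U₂, W, hU₂, hW, hy₀U₂, hy₁W, hdisj⟩ := t2_separation hne.symm
  obtain ⟨B, hB, hAB, hBD, P, hP, hmod⟩ := exists_compact_modulus_le hn0 hD.1 hQm hQ hA.1 hAD
  obtain ⟨V, hV, hVU, hflat⟩ := hD'flat y₀ hy₀D (P.toReal + 1) (by positivity) (U₁ ∩ U₂)
    ((hU₁.inter hU₂).mem_nhds ⟨hy₀U₁, hy₀U₂⟩)
  -- One of the images reaches into `V`; it leaves `U₁ ∩ U₂` because of its diameter.
  obtain ⟨a, haV, ha⟩ := mem_closure_iff_nhds.1 hy₀ V hV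
  obtain ⟨m, ha⟩ := mem_iUnion.1 ha
  have hEc : IsContinuum (f m '' A) :=
    ⟨hA.1.image_of_continuousOn ((hf m).continuousOn.mono hAD),
      hA.2.image _ ((hf m).continuousOn.mono hAD)⟩
  have hED : f m '' A ⊆ D' := (hf m).image_eq ▸ image_mono hAD
  obtain ⟨b, hbE, hbU⟩ := not_subset.1 (hsmall _ (hA.2.nonempty.image _) (hfA m))
  -- The second continuum runs along the boundary component from `V` to `W`, off the compact set
  -- `f m '' B`.
  have hpc : IsPathConnected D' := by
    rw [← (hf m).image_eq]
    exact (hD.1.isConnected_iff_isPathConnected.1 hD.2).image' (hf m).continuousOn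
  obtain ⟨N₀, hN₀, N₁, hN₁, hjoin⟩ := exists_joinedIn_of_isPreconnected
    isPreconnected_connectedComponentIn
    ((connectedComponentIn_subset _ y₀).trans frontier_subset_closure)
    (fun y hy => exists_nhds_joinedIn hn0 hD'.1 hpc hD'flat
      (hB.image_of_continuousOn ((hf m).continuousOn.mono hBD)) ((hA.2.nonempty.mono hAB).image _)
      ((hf m).image_eq ▸ image_mono hBD) (connectedComponentIn_subset _ y₀ hy))
    (mem_connectedComponentIn hy₀D) hy₁
  obtain ⟨p, ⟨hpN, hpV⟩, hpD⟩ := mem_closure_iff_nhds.1 (frontier_subset_closure hy₀D) _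
    (inter_mem hN₀ hV)
  obtain ⟨q, ⟨hqN, hqW⟩, hqD⟩ := mem_closure_iff_nhds.1
    (frontier_subset_closure (connectedComponentIn_subset _ y₀ hy₁)) _
    (inter_mem hN₁ (hW.mem_nhds hy₁W))
  have hqU : q ∉ U₁ ∩ U₂ := fun h => disjoint_left.1 hdisj h.2 hqW
  obtain ⟨γ, hγ⟩ := hjoin p ⟨hpN, hpD⟩ q ⟨hqN, hqD⟩
  have hF : IsContinuum (range γ) := ⟨isCompact_range γ.continuous, isConnected_range γ.continuous⟩
  have hFD : range γ ⊆ D' \ f m '' B := range_subset_iff.2 hγ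
  have hpF : p ∈ range γ := ⟨0, γ.source⟩
  have hqF : q ∈ range γ := ⟨1, γ.target⟩
  have hlt := hflat _ _ hEc hF hED (hFD.trans sdiff_subset)
    (hEc.2.isPreconnected.nonempty_inter_frontier ⟨a, ha, hVU haV⟩ ⟨b, hbE, fun h => hbU h.1⟩)
    (hEc.2.isPreconnected.nonempty_inter_frontier ⟨a, ha, haV⟩ ⟨b, hbE, fun h => hbU (hVU h).1⟩)
    (hF.2.isPreconnected.nonempty_inter_frontier ⟨p, hpF, hVU hpV⟩ ⟨q, hqF, hqU⟩)
    (hF.2.isPreconnected.nonempty_inter_frontier ⟨p, hpF, hpV⟩ ⟨q, hqF, fun h => hqU (hVU h)⟩)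
  refine absurd (hlt.trans_le (hmod D' (f m) (hf m) _ hFD)) (not_lt.2 ?_)
  calc P = ENNReal.ofReal P.toReal := (ENNReal.ofReal_toReal hP).symm
    _ ≤ ENNReal.ofReal (P.toReal + 1) := ENNReal.ofReal_le_ofReal (by linarith)
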